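/- Let the Jacobi-Stirling numbers of the second kind $\mathrm{JS}(n,k;z)\in\mathbb Z[z]$ be defined by $$x^n=\sum_{k=0}^{n}\mathrm{JS}(n,k;z)\prod_{m=0}^{k-1}\bigl(x-m(z+m)\bigr)\qquad(n\ge 0),$$ and let $p_{k,i}(n)$ be the coefficient of $z^i$ in $\mathrm{JS}(n+k,n;z)$. For $k\ge 1$, order the letters by $\bar1<1<\bar2<2<\dots<\bar k<k$, and let $M_k=\{1,1,\bar1,2,2,\bar2,\dots,k,k,\bar k\}$ (a multiset). For $S\subseteq\{\bar1,\dots,\bar k\}$, a permutation $\pi$ of the multiset $M_k\setminus S$ is called a Jacobi-Stirling permutation if $\pi(v)>\pi(u)$ whenever $u<v<w$ and $\pi(u)=\pi(w)$. Let $\mathcal{JSP}_{k,i}$ be the set of all Jacobi-Stirling permutations of the multisets $M_k\setminus S$, over all $S\subseteq\{\bar1,\dots,\bar k\}$ with $|S|=i$. A descent of a word $\pi=\pi_1\cdots\pi_m$ is an index $l$ with $1\le l\le m-1$ and $\pi_l>\pi_{l+1}$. Theorem. Let $k\ge 1$ and $0\le i\le k$. Then there are integers $a_{k,i,j}$ ($1\le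 j\le 2k-i$), necessarily unique, such that, as formal power series in $t$, $$\sum_{n\ge 0}p_{k,i}(n)\,t^n=\frac{\sum_{j=1}^{2k-i}a_{k,i,j}\,t^j}{(1-t)^{3k-i+1}},$$ and for every $1\le j\le 2k-i$ the integer $a_{k,i,j}$ is the number of permutations in $\mathcal{JSP}_{k,i}$ with exactly $j-1$ descents. -/

import Mathlib

namespace JacobiStirling

open Polynomial

/-! ### Jacobi-Stirling numbers of the second kind

Polynomials in `z` with integer coefficients are elements of `ℤ[X]`; polynomials in `x` over them
are elements of `ℤ[X][X]`. -/

/-- The polynomial `∏_{i=0}^{k-1} (x - i (z + i))` in `x`, with coefficients in `ℤ[z]`. -/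
noncomputable def basisPoly (k : ℕ) : ℤ[X][X] :=
  ∏ i ∈ Finset.range k, (X - C ((i : ℤ[X]) * (X + (i : ℤ[X]))))

/-- `J n k` are the connection coefficients in
`x ^ n = ∑_{k=0}^{n} J(n,k;z) ∏_{i=0}^{k-1} (x - i (z + i))`, extended by `0` to `k > n`. -/
def IsConnection (J : ℕ → ℕ → ℤ[X]) : Prop :=
  (∀ n : ℕ, (X : ℤ[X][X]) ^ n = ∑ k ∈ Finset.range (n + 1), C (J n k) * basisPoly k) ∧
    ∀ n k : ℕ, n < k → J n k = 0

/-- Auxiliary numbers, used only to show that the connection coefficients exist. -/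
noncomputable def connectionAux : ℕ → ℕ → ℤ[X]
  | 0, 0 => 1
  | 0, _ + 1 => 0
  | _ + 1, 0 => 0
  | n + 1, k + 1 => connectionAux n k +
      (((k + 1 : ℕ) : ℤ[X]) * (X + ((k + 1 : ℕ) : ℤ[X]))) * connectionAux n (k + 1)

theorem connectionAux_eq_zero : ∀ n k : ℕ, n < k → connectionAux n k = 0
  | _, 0, h => absurd h (Nat.not_lt_zero _)
  | 0, _ + 1, _ => by rw [connectionAux]
  | n + 1, k + 1, h => by
      rw [connectionAux, connectionAux_eq_zero n k (by omega),
        connectionAux_eq_zero n (k + 1) (by omega)]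
      simp

theorem basisPoly_succ (k : ℕ) :
    basisPoly (k + 1) = basisPoly k * (X - C ((k : ℤ[X]) * (X + (k : ℤ[X])))) := by
  rw [basisPoly, Finset.prod_range_succ, ← basisPoly]

theorem connectionAux_isConnection : IsConnection connectionAux := by
  refine ⟨fun n => ?_, connectionAux_eq_zero⟩
  induction n with
  | zero => simp [connectionAux, basisPoly]
  | succ n ih =>
    have key : ∀ k, X * (C (connectionAux n k) * basisPoly k) =
        C (connectionAux n k) * basisPoly (k + 1) +
          C (((k : ℤ[X]) * (X + (k : ℤ[X]))) * connectionAux n k) * basisPoly k := by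
      intro k
      rw [basisPoly_succ, C_mul (a := (k : ℤ[X]) * (X + (k : ℤ[X])))]
      ring
    rw [pow_succ', ih, Finset.mul_sum, Finset.sum_congr rfl (fun k _ => key k),
      Finset.sum_add_distrib, Finset.sum_range_succ' _ (n + 1)]
    have h0 : connectionAux (n + 1) 0 = 0 := by rw [connectionAux]
    have hs : ∀ k, connectionAux (n + 1) (k + 1) = connectionAux n k +
      (((k + 1 : ℕ) : ℤ[X]) * (X + ((k + 1 : ℕ) : ℤ[X]))) * connectionAux n (k + 1) := by
      intro k
      rw [connectionAux]
    simp only [hs, C_add, add_mul, Finset.sum_add_distrib, h0, C_0, zero_mul, add_zero]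
    congr 1
    rw [Finset.sum_range_succ' _ n, Finset.sum_range_succ _ n,
      connectionAux_eq_zero n (n + 1) (Nat.lt_succ_self n)]
    simp

theorem basisPoly_monic (k : ℕ) : (basisPoly k).Monic :=
  monic_prod_of_monic _ _ fun _ _ => monic_X_sub_C _

theorem basisPoly_natDegree (k : ℕ) : (basisPoly k).natDegree = k := by
  rw [basisPoly, natDegree_prod_of_monic _ _ fun _ _ => monic_X_sub_C _]
  simp only [natDegree_X_sub_C, Finset.sum_const, Finset.card_range, smul_eq_mul, mul_one]

theorem basisPoly_independent (c : ℕ → ℤ[X]) (N : ℕ)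
    (h : ∑ k ∈ Finset.range N, C (c k) * basisPoly k = 0) : ∀ k < N, c k = 0 := by
  induction N with
  | zero => intro k hk; omega
  | succ N ih =>
    have hN : c N = 0 := by
      have h1 := congrArg (fun p => p.coeff N) h
      have h2 : (basisPoly N).coeff N = 1 := by
        have := (basisPoly_monic N).coeff_natDegree
        rwa [basisPoly_natDegree] at this
      have h3 : ∑ k ∈ Finset.range N, (C (c k) * basisPoly k).coeff N = 0 := by
        refine Finset.sum_eq_zero fun k hk => ?_
        rw [coeff_C_mul, coeff_eq_zero_of_natDegree_lt, mul_zero]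
        rw [basisPoly_natDegree]
        exact Finset.mem_range.mp hk
      simp only [Finset.sum_range_succ, coeff_add, finsetSum_coeff, coeff_zero] at h1
      rwa [h3, coeff_C_mul, h2, zero_add, mul_one] at h1
    rw [Finset.sum_range_succ, hN, C_0, zero_mul, add_zero] at h
    intro k hk
    rcases Nat.lt_succ_iff_lt_or_eq.mp hk with hk | rfl
    · exact ih h k hk
    · exact hN

theorem existsUnique_isConnection : ∃! J : ℕ → ℕ → ℤ[X], IsConnection J := by
  refine ⟨connectionAux, connectionAux_isConnection, fun J hJ => ?_⟩
  funext n k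
  by_cases hk : n < k
  · rw [hJ.2 n k hk, connectionAux_eq_zero n k hk]
  · refine sub_eq_zero.mp
      (basisPoly_independent (fun k => J n k - connectionAux n k) (n + 1) ?_ k (by omega))
    simp only [C_sub, sub_mul, Finset.sum_sub_distrib]
    rw [← hJ.1 n, ← connectionAux_isConnection.1 n, sub_self]

/-- The Jacobi-Stirling number of the second kind `JS(n,k;z)`, as a polynomial in `z`:
the unique connection coefficients. -/
noncomputable def JS : ℕ → ℕ → ℤ[X] := existsUnique_isConnection.choose

theorem JS_isConnection : IsConnection JS := existsUnique_isConnection.choose_spec.1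

/-- The Jacobi-Stirling coefficient `p_{k,i}(n)`: the coefficient of `z ^ i` in
`f_k(n;z) = JS(n+k,n;z)`. -/
noncomputable def p (k i n : ℕ) : ℤ := (JS (n + k) n).coeff i

/-- The power series `A_{k,i}(t) = (1 - t)^{3k-i+1} ∑_{n ≥ 0} p_{k,i}(n) t^n`. -/
noncomputable def A (k i : ℕ) : PowerSeries ℤ :=
  (1 - PowerSeries.X) ^ (3 * k - i + 1) * PowerSeries.mk (fun n => p k i n)

/-- The coefficient `a_{k,i,j}` of `t ^ j` in `A_{k,i}(t)`. -/
noncomputable def a (k i j : ℕ) : ℤ := PowerSeries.coeff j (A k i)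

/-! ### Jacobi-Stirling permutations -/

/-- Letters, with the lexicographic order and `false < true` in the second component. -/
abbrev Letter : Type := ℕ ×ₗ Bool

/-- The unbarred letter `m`. -/
def plain (m : ℕ) : Letter := toLex (m, true)

/-- The barred letter `m̄`; so `1̄ < 1 < 2̄ < 2 < ⋯`. -/
def bar (m : ℕ) : Letter := toLex (m, false)

theorem bar_lt_plain (m : ℕ) : bar m < plain m :=
  Prod.Lex.toLex_lt_toLex.mpr (Or.inr ⟨rfl, Bool.false_lt_true⟩)

theorem plain_lt_bar {m n : ℕ} (h : m < n) : plain m < bar n :=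
  Prod.Lex.toLex_lt_toLex.mpr (Or.inl h)

/-- The multiset `M_k = {1, 1, 1̄, 2, 2, 2̄, …, k, k, k̄}`. -/
def M (k : ℕ) : Multiset Letter :=
  ∑ m ∈ Finset.Icc 1 k, {plain m, plain m, bar m}

/-- The set `[k̄] = {1̄, 2̄, …, k̄}` of barred letters. -/
def barred (k : ℕ) : Finset Letter := (Finset.Icc 1 k).image bar

/-- A word `π` is Jacobi-Stirling if whenever `u < v < w` and `π(u) = π(w)`, `π(v) > π(u)`. -/
def IsJacobiStirling (π : List Letter) : Prop :=
  ∀ u v w : Fin π.length, u < v → v < w → π[u] = π[w] → π[v] > π[u]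

instance (π : List Letter) : Decidable (IsJacobiStirling π) := by
  unfold IsJacobiStirling
  infer_instance

/-- The Jacobi-Stirling permutations of the multiset `M_{k,S} = M_k \ S`. -/
def JSPS (k : ℕ) (S : Finset Letter) : Finset (List Letter) :=
  (M k - S.val).lists.toFinset.filter IsJacobiStirling

theorem mem_JSPS (k : ℕ) (S : Finset Letter) (π : List Letter) :
    π ∈ JSPS k S ↔ (π : Multiset Letter) = M k - S.val ∧ IsJacobiStirling π := by
  rw [JSPS, Finset.mem_filter, Multiset.mem_toFinset, Multiset.mem_lists_iff, eq_comm]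
  rfl

/-- The union of the sets of Jacobi-Stirling permutations of `M_{k,S}` over all subsets `S` of
`[k̄]` of cardinality `i`. -/
def JSP (k i : ℕ) : Finset (List Letter) :=
  ((barred k).powersetCard i).biUnion fun S => JSPS k S

/-- The number of descents of `π`: the number of positions `l`, counted from `0`, such that
`l + 1` is also a position and `π_l > π_{l+1}`. -/
def des (π : List Letter) : ℕ :=
  Fintype.card {l : Fin (π.length - 1) // π[l.val] > π[l.val + 1]}

end JacobiStirling

namespace JacobiStirling

open Polynomial

/-! ### Power series: the recursion for `A k i` -/

/-! Both sides obey the same recursion in `k`. Write `F k i = ∑ p k i n t^n` and `θ = t d/dt`. The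
triangular recurrence of the Jacobi-Stirling numbers gives `(1 - t) F (k+1) (i+1) = θ (F k i) + θ²
(F k (i+1))`. If `F = N / (1 - t)^d`, then `θ F` has numerator `eulerOp d N` over `(1 - t)^(d+1)`
(`eulerOp_one_sub_X_pow_mul`), so `A` satisfies a recursion in `eulerOp` (`A_succ_zero`,
`A_succ_succ`).

On words, take one of length `d - 1` with `j - 1` descents and insert a block of a letter larger
than all others. Of the `d` slots, `j` keep the number of descents and `d - j` raise it by one: this
is `eulerOp d` acting on `t^j` (`sum_X_pow_descents_insertBlock`). Every Jacobi-Stirling permutation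
at level `k + 1` arises uniquely from level `k` by inserting the barred letter, unless it is
omitted, and then the adjacent pair of plain letters (`sum_nestedWords_add_replicate`). This gives
the same recursion (`jspSeries_succ_succ`). -/

theorem JS_eq_connectionAux : JS = connectionAux :=
  existsUnique_isConnection.unique JS_isConnection connectionAux_isConnection

theorem p_zero_left (i n : ℕ) : p 0 i n = if i = 0 then 1 else 0 := by
  have h : ∀ n, connectionAux n n = 1 := by
    intro n
    induction n with
    | zero => rw [connectionAux]
    | succ n ih =>
      rw [connectionAux, ih, connectionAux_eq_zero n (n + 1) (Nat.lt_succ_self n)]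
      simp
  rw [p, JS_eq_connectionAux, add_zero, h, coeff_one]

theorem p_succ_zero (k i : ℕ) : p (k + 1) i 0 = 0 := by
  rw [p, JS_eq_connectionAux, zero_add, connectionAux, coeff_zero]

/-- The factor `(n+1)(z + n + 1)` is split so that the coefficient of `z^i` can be read off term by
term. -/
theorem connectionAux_diagonal_succ (k n : ℕ) :
    connectionAux (n + 1 + (k + 1)) (n + 1) = connectionAux (n + (k + 1)) n +
      ((n + 1 : ℕ) : ℤ[X]) * (X * connectionAux (n + 1 + k) (n + 1)) +
      ((n + 1 : ℕ) : ℤ[X]) * (((n + 1 : ℕ) : ℤ[X]) * connectionAux (n + 1 + k) (n + 1)) := by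
  rw [show n + 1 + (k + 1) = n + (k + 1) + 1 by omega, connectionAux,
    show n + (k + 1) = n + 1 + k by omega]
  ring

theorem p_succ_succ (k i n : ℕ) :
    p (k + 1) (i + 1) (n + 1) = p (k + 1) (i + 1) n + ((n + 1 : ℕ) : ℤ) * p k i (n + 1) +
      ((n + 1 : ℕ) : ℤ) * (((n + 1 : ℕ) : ℤ) * p k (i + 1) (n + 1)) := by
  simp only [p, JS_eq_connectionAux]
  rw [connectionAux_diagonal_succ]
  simp only [coeff_add, coeff_natCast_mul, coeff_X_mul]

theorem p_succ_zero_succ (k n : ℕ) :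
    p (k + 1) 0 (n + 1) = p (k + 1) 0 n +
      ((n + 1 : ℕ) : ℤ) * (((n + 1 : ℕ) : ℤ) * p k 0 (n + 1)) := by
  simp only [p, JS_eq_connectionAux]
  rw [connectionAux_diagonal_succ]
  simp only [coeff_add, coeff_natCast_mul, coeff_X_mul_zero, mul_zero, add_zero]

theorem p_eq_zero_of_lt {k i : ℕ} (h : k < i) (n : ℕ) : p k i n = 0 := by
  induction k generalizing i n with
  | zero => rw [p_zero_left, if_neg (by omega)]
  | succ k ih =>
    obtain ⟨i, rfl⟩ : ∃ j, i = j + 1 := ⟨i - 1, by omega⟩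
    induction n with
    | zero => exact p_succ_zero _ _
    | succ n ihn => rw [p_succ_succ, ihn, ih (by omega), ih (by omega)]; simp

theorem A_eq_zero_of_lt {k i : ℕ} (h : k < i) : A k i = 0 := by
  have : (PowerSeries.mk fun n => p k i n) = 0 := by
    ext n
    simp [p_eq_zero_of_lt h]
  rw [A, this, mul_zero]

theorem A_zero_zero : A 0 0 = 1 := by
  have : (PowerSeries.mk fun n => p 0 0 n) = PowerSeries.mk 1 := by
    ext n
    simp [p_zero_left]
  rw [A, this]
  simpa [mul_comm] using PowerSeries.mk_one_mul_one_sub_eq_one ℤ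

/-- The operator `f ↦ t (1 - t) f' + d t f`, which sends `t ^ j` to `j t ^ j + (d - j) t ^ (j + 1)`.
It describes how `t d/dt` acts on numerators over `(1 - t) ^ d`. -/
noncomputable def eulerOp (d : ℕ) (f : PowerSeries ℤ) : PowerSeries ℤ :=
  PowerSeries.X * (1 - PowerSeries.X) * PowerSeries.derivative ℤ f +
    (d : PowerSeries ℤ) * PowerSeries.X * f

theorem eulerOp_zero (d : ℕ) : eulerOp d 0 = 0 := by
  simp [eulerOp]

theorem eulerOp_sum {ι : Type*} (d : ℕ) (s : Finset ι) (f : ι → PowerSeries ℤ) :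
    eulerOp d (∑ x ∈ s, f x) = ∑ x ∈ s, eulerOp d (f x) := by
  simp only [eulerOp, map_sum, Finset.mul_sum, Finset.sum_add_distrib]

theorem eulerOp_X_pow_succ (d j : ℕ) :
    eulerOp d (PowerSeries.X ^ (j + 1)) =
      ((j : PowerSeries ℤ) + 1) * PowerSeries.X ^ (j + 1) +
        ((d : PowerSeries ℤ) - ((j : PowerSeries ℤ) + 1)) * PowerSeries.X ^ (j + 2) := by
  rw [eulerOp, PowerSeries.derivative_pow, PowerSeries.derivative_X]
  push_cast
  ring

theorem coeff_eulerOp_succ (d j : ℕ) (f : PowerSeries ℤ) :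
    PowerSeries.coeff (j + 1) (eulerOp d f) =
      ((j : ℤ) + 1) * PowerSeries.coeff (j + 1) f +
        ((d : ℤ) - j) * PowerSeries.coeff j f := by
  have h : eulerOp d f = PowerSeries.X * (PowerSeries.derivative ℤ f -
      PowerSeries.X * PowerSeries.derivative ℤ f + PowerSeries.C (d : ℤ) * f) := by
    rw [eulerOp, map_natCast]
    ring
  rw [h, PowerSeries.coeff_succ_X_mul, map_add, map_sub, PowerSeries.coeff_C_mul,
    PowerSeries.coeff_derivative]
  cases j with
  | zero => simp
  | succ j =>
    rw [PowerSeries.coeff_succ_X_mul, PowerSeries.coeff_derivative]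
    push_cast
    ring

/-- In the product rule, differentiating `(1 - t)^d` contributes `-d t (1 - t)^d f`, which the
second term of `eulerOp` cancels. -/
theorem eulerOp_one_sub_X_pow_mul (d : ℕ) (f : PowerSeries ℤ) :
    eulerOp d ((1 - PowerSeries.X) ^ d * f) =
      (1 - PowerSeries.X) ^ (d + 1) * (PowerSeries.X * PowerSeries.derivative ℤ f) := by
  rw [eulerOp, Derivation.leibniz, PowerSeries.derivative_pow, map_sub, PowerSeries.derivative_X,
    PowerSeries.derivative_one, smul_eq_mul, smul_eq_mul]
  cases d with
  | zero => simp; ring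
  | succ d =>
    rw [Nat.add_sub_cancel]
    ring

theorem one_sub_X_mul_mk_p_succ (k i : ℕ) :
    (1 - PowerSeries.X) * PowerSeries.mk (fun n => p (k + 1) (i + 1) n) =
      PowerSeries.X * PowerSeries.derivative ℤ (PowerSeries.mk fun n => p k i n) +
      PowerSeries.X * PowerSeries.derivative ℤ
        (PowerSeries.X * PowerSeries.derivative ℤ (PowerSeries.mk fun n => p k (i + 1) n)) := by
  ext n
  rw [sub_mul, one_mul]
  cases n with
  | zero => simp [p_succ_zero]
  | succ n =>
    simp only [map_sub, map_add, PowerSeries.coeff_succ_X_mul, PowerSeries.coeff_derivative,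
      PowerSeries.coeff_mk, p_succ_succ k i n]
    push_cast
    ring

theorem one_sub_X_mul_mk_p_zero (k : ℕ) :
    (1 - PowerSeries.X) * PowerSeries.mk (fun n => p (k + 1) 0 n) =
      PowerSeries.X * PowerSeries.derivative ℤ
        (PowerSeries.X * PowerSeries.derivative ℤ (PowerSeries.mk fun n => p k 0 n)) := by
  ext n
  rw [sub_mul, one_mul]
  cases n with
  | zero => simp [p_succ_zero]
  | succ n =>
    simp only [map_sub, PowerSeries.coeff_succ_X_mul, PowerSeries.coeff_derivative,
      PowerSeries.coeff_mk, p_succ_zero_succ k n]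
    push_cast
    ring

theorem A_succ_zero (k : ℕ) :
    A (k + 1) 0 = eulerOp (3 * k + 2) (eulerOp (3 * k + 1) (A k 0)) := by
  rw [A, A, show 3 * k - 0 + 1 = 3 * k + 1 by omega, eulerOp_one_sub_X_pow_mul,
    eulerOp_one_sub_X_pow_mul, ← one_sub_X_mul_mk_p_zero,
    show 3 * (k + 1) - 0 + 1 = (3 * k + 2 + 1) + 1 by omega, pow_succ, mul_assoc]

theorem A_succ_succ {k i : ℕ} (h : i ≤ k) :
    A (k + 1) (i + 1) = eulerOp (3 * k - i + 1) (A k i) +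
      eulerOp (3 * k - i + 1) (eulerOp (3 * k - i) (A k (i + 1))) := by
  -- At `k = i = 0` truncated subtraction makes the exponent in `A k (i + 1)` equal to 1 rather than
  -- 0; there the series itself vanishes.
  have h1 : A k (i + 1) = (1 - PowerSeries.X) ^ (3 * k - i) *
      PowerSeries.mk (fun n => p k (i + 1) n) := by
    rcases Nat.lt_or_ge k (i + 1) with hk | hk
    · have : (PowerSeries.mk fun n => p k (i + 1) n) = 0 := by
        ext n
        simp [p_eq_zero_of_lt hk]
      rw [A, this, mul_zero, mul_zero]
    · rw [A, show 3 * k - (i + 1) + 1 = 3 * k - i by omega]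
  rw [h1, eulerOp_one_sub_X_pow_mul, eulerOp_one_sub_X_pow_mul, A, A, eulerOp_one_sub_X_pow_mul,
    ← mul_add, ← one_sub_X_mul_mk_p_succ,
    show 3 * (k + 1) - (i + 1) + 1 = (3 * k - i + 1 + 1) + 1 by omega, pow_succ, mul_assoc]

theorem coeff_eulerOp_of_lt {d m : ℕ} {f : PowerSeries ℤ}
    (hf : ∀ j, m < j → PowerSeries.coeff j f = 0) (j : ℕ) (hj : m + 1 < j) :
    PowerSeries.coeff j (eulerOp d f) = 0 := by
  obtain ⟨j, rfl⟩ : ∃ l, j = l + 1 := ⟨j - 1, by omega⟩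
  rw [coeff_eulerOp_succ, hf j (by omega), hf (j + 1) (by omega)]
  simp

/-- Each `eulerOp` raises the degree by at most one, and both terms of the recursion respect the
bound `2k - i`. -/
theorem coeff_A_of_lt {k i : ℕ} (hi : i ≤ k) (j : ℕ) (hj : 2 * k - i < j) :
    PowerSeries.coeff j (A k i) = 0 := by
  induction k generalizing i j with
  | zero =>
    obtain rfl : i = 0 := by omega
    rw [A_zero_zero, PowerSeries.coeff_one, if_neg (by omega)]
  | succ k ih =>
    cases i with
    | zero =>
      rw [A_succ_zero]
      exact coeff_eulerOp_of_lt (coeff_eulerOp_of_lt (ih (Nat.zero_le k))) j (by omega)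
    | succ i =>
      rw [A_succ_succ (by omega), map_add,
        coeff_eulerOp_of_lt (ih (i := i) (by omega)) j (by omega), zero_add]
      rcases Nat.lt_or_ge k (i + 1) with hk | hk
      · rw [A_eq_zero_of_lt hk, eulerOp_zero, eulerOp_zero, map_zero]
      · exact coeff_eulerOp_of_lt (coeff_eulerOp_of_lt (ih hk)) j (by omega)

theorem coeff_zero_A_succ (k i : ℕ) : PowerSeries.coeff 0 (A (k + 1) i) = 0 := by
  simp [A, p_succ_zero]

/-! ### Jacobi-Stirling words and insertion of a maximal letter -/

section Words

variable {α : Type*}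

/-- The word obtained from `w` by inserting the block `x ^ n` at position `g`. -/
def insertBlock (x : α) (n g : ℕ) (w : List α) : List α :=
  w.take g ++ List.replicate n x ++ w.drop g

theorem insertBlock_zero (x : α) (n : ℕ) (w : List α) :
    insertBlock x n 0 w = List.replicate n x ++ w := by
  simp [insertBlock]

theorem insertBlock_succ_cons (x y : α) (n g : ℕ) (w : List α) :
    insertBlock x n (g + 1) (y :: w) = y :: insertBlock x n g w := by
  simp [insertBlock]

theorem sublist_of_cons_sublist_append {x : α} {l s t : List α} (hs : x ∉ s)
    (h : List.Sublist (x :: l) (s ++ t)) : List.Sublist (x :: l) t := by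
  induction s with
  | nil => simpa using h
  | cons c s ih =>
    rw [List.mem_cons, not_or] at hs
    rw [List.cons_append, List.sublist_cons_iff] at h
    rcases h with h | ⟨r, hr, -⟩
    · exact ih hs.2 h
    · exact absurd (List.cons.inj hr).1 hs.1

variable [LinearOrder α]

/-- The number of descents of a word, by recursion on the word. -/
def descents : List α → ℕ
  | [] => 0
  | [_] => 0
  | a :: b :: l => (if b < a then 1 else 0) + descents (b :: l)

theorem descents_cons_cons (a b : α) (l : List α) :
    descents (a :: b :: l) = (if b < a then 1 else 0) + descents (b :: l) := by
  rw [descents]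

theorem card_descent_positions (w : List α) :
    Fintype.card {l : Fin (w.length - 1) // w[l.val] > w[l.val + 1]} = descents w := by
  rw [Fintype.card_subtype]
  simp only [gt_iff_lt]
  induction w with
  | nil => rfl
  | cons a w ih =>
    cases w with
    | nil => rfl
    | cons b l =>
      rw [descents_cons_cons, ← ih, Finset.card_filter, Finset.card_filter]
      refine (Fin.sum_univ_succ (n := l.length) _).trans ?_
      rfl

theorem descents_replicate_succ (x : α) (n : ℕ) :
    descents (List.replicate (n + 1) x) = 0 := by
  induction n with
  | zero => rfl
  | succ n ih =>
    rw [List.replicate_succ, List.replicate_succ, descents_cons_cons, if_neg (lt_irrefl x),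
      ← List.replicate_succ, ih]

theorem descents_replicate_append (x y : α) (n : ℕ) (w : List α) (h : y < x) :
    descents (List.replicate (n + 1) x ++ y :: w) = descents (y :: w) + 1 := by
  induction n with
  | zero => simp [descents_cons_cons, h, add_comm]
  | succ n ih =>
    rw [List.replicate_succ, List.cons_append, List.replicate_succ, List.cons_append,
      descents_cons_cons, if_neg (lt_irrefl x), ← List.cons_append, ← List.replicate_succ, ih,
      zero_add]

/-- A block of a maximal letter placed inside a descent or at the end leaves the number of descents
unchanged; in every other slot it creates exactly one. -/
theorem sum_X_pow_descents_insertBlock (x : α) (n : ℕ) (w : List α) (h : ∀ y ∈ w, y < x) :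
    ∑ g ∈ Finset.range (w.length + 1),
        (PowerSeries.X : PowerSeries ℤ) ^ (descents (insertBlock x (n + 1) g w) + 1) =
      eulerOp (w.length + 1) (PowerSeries.X ^ (descents w + 1)) := by
  rw [eulerOp_X_pow_succ]
  induction w with
  | nil => simp [insertBlock, descents_replicate_succ, descents]
  | cons a w ih =>
    have ih := ih fun y hy => h y (List.mem_cons_of_mem _ hy)
    have hax : a < x := h a List.mem_cons_self
    rw [Finset.sum_range_succ', insertBlock_zero, descents_replicate_append x a n w hax]
    simp only [insertBlock_succ_cons]
    cases w with
    | nil =>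
      have : descents (a :: List.replicate (n + 1) x) = 0 := by
        rw [List.replicate_succ, descents_cons_cons, ← List.replicate_succ,
          descents_replicate_succ, if_neg hax.not_gt]
      norm_num [insertBlock, this, descents]
    | cons c l =>
      have hcx : c < x := h c (by simp)
      -- The slots before `a` and between `a` and `c` are treated separately. All later slots keep
      -- `a` and `c` adjacent, so the factor for that pair comes out of the sum and the induction
      -- hypothesis applies.
      rw [Finset.sum_range_succ', insertBlock_zero, descents_replicate_append x c n l hcx] at ih
      rw [List.length_cons, Finset.sum_range_succ', insertBlock_zero, List.replicate_succ,
        List.cons_append, descents_cons_cons, if_neg hax.not_gt, ← List.cons_append,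
        ← List.replicate_succ, descents_replicate_append x c n l hcx]
      simp only [insertBlock_succ_cons, descents_cons_cons a c] at ih ⊢
      have ih' := eq_sub_of_add_eq ih
      simp only [add_assoc, pow_add _ (ite _ _ _) _, ← Finset.mul_sum] at ih' ⊢
      rw [ih']
      push_cast [List.length_cons]
      split <;> ring

/-- A word in which the letters between two equal letters are larger than these. -/
def IsNested (w : List α) : Prop :=
  ∀ a y, List.Sublist [a, y, a] w → a < y

theorem IsNested.sublist {v w : List α} (hw : IsNested w) (h : v.Sublist w) : IsNested v :=
  fun a y hs => hw a y (hs.trans h)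

/-- The sublist form passes directly to subwords and through `filter`, which suits inserting and
deleting letters. -/
theorem forall_fin_lt_iff_isNested (w : List α) :
    (∀ u v t : Fin w.length, u < v → v < t → w[u] = w[t] → w[v] > w[u]) ↔ IsNested w := by
  constructor
  · intro H a y hs
    obtain ⟨f, hf⟩ := List.sublist_iff_exists_fin_orderEmbedding_get_eq.mp hs
    have h0 := hf ⟨0, by simp⟩
    have h1 := hf ⟨1, by simp⟩
    have h2 := hf ⟨2, by simp⟩
    have := H (f ⟨0, by simp⟩) (f ⟨1, by simp⟩) (f ⟨2, by simp⟩)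
      (f.lt_iff_lt.2 (by simp)) (f.lt_iff_lt.2 (by simp)) (h0.symm.trans h2)
    simp only [List.get_eq_getElem] at h0 h1
    simp only [Fin.getElem_fin, ← h0, ← h1] at this
    simpa using this
  · intro H u v t huv hvt e
    refine H w[u] w[v] (List.sublist_iff_exists_fin_orderEmbedding_get_eq.mpr
      ⟨OrderEmbedding.ofStrictMono ![u, v, t] ?_, ?_⟩)
    · rw [Fin.strictMono_iff_lt_succ]
      intro i
      fin_cases i
      · exact huv
      · exact hvt
    · intro i
      fin_cases i
      · rfl
      · rfl
      · exact e

theorem filter_ne_append_replicate_append {x : α} {s t : List α} (n : ℕ) (hs : x ∉ s)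
    (ht : x ∉ t) :
    (s ++ List.replicate n x ++ t).filter (fun y => decide (y ≠ x)) = s ++ t := by
  have h : ∀ r : List α, x ∉ r → r.filter (fun y => decide (y ≠ x)) = r := fun r hr =>
    List.filter_eq_self.mpr fun y hy => decide_eq_true fun e => hr (e ▸ hy)
  rw [List.filter_append, List.filter_append, h s hs, h t ht]
  simp

/-- A pattern `a y a` with `a = x` would need three copies of `x` or a foreign letter inside the
block. If only `y = x`, maximality of `x` suffices; otherwise deleting the block moves the pattern
into `s ++ t`. -/
theorem IsNested.append_replicate_append {x : α} {n : ℕ} (hn : n ≤ 2) {s t : List α}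
    (hs : ∀ y ∈ s, y < x) (ht : ∀ y ∈ t, y < x) (h : IsNested (s ++ t)) :
    IsNested (s ++ List.replicate n x ++ t) := by
  have hxs : x ∉ s := fun hx => lt_irrefl x (hs x hx)
  have hxt : x ∉ t := fun hx => lt_irrefl x (ht x hx)
  intro a y hsub
  by_cases hax : a = x
  · subst hax
    exfalso
    rw [List.append_assoc] at hsub
    have h1 := sublist_of_cons_sublist_append hxs hsub
    by_cases hya : y = a
    · subst hya
      have := h1.count_le y
      simp [List.count_eq_zero_of_not_mem hxt] at this
      omega
    · have h2 : List.Sublist [y, a] t := by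
        refine sublist_of_cons_sublist_append (s := List.replicate n a) ?_
          ((List.sublist_cons_self a _).trans h1)
        intro hy
        exact hya (List.eq_of_mem_replicate hy)
      exact hxt (h2.subset (by simp))
  · have hle : ∀ z ∈ s ++ List.replicate n x ++ t, z ≤ x := by
      intro z hz
      rw [List.mem_append, List.mem_append] at hz
      rcases hz with (hz | hz) | hz
      · exact (hs z hz).le
      · exact (List.eq_of_mem_replicate hz).le
      · exact (ht z hz).le
    by_cases hyx : y = x
    · subst hyx
      exact lt_of_le_of_ne (hle a (hsub.subset (by simp))) hax
    · refine h a y ?_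
      have := hsub.filter (fun y => decide (y ≠ x))
      rw [filter_ne_append_replicate_append n hxs hxt] at this
      simpa [hax, hyx] using this

/-- The nested words which are arrangements of the multiset `m`. -/
noncomputable def nestedWords (m : Multiset α) : Finset (List α) :=
  haveI : DecidablePred (IsNested (α := α)) := Classical.decPred _
  m.lists.toFinset.filter IsNested

theorem mem_nestedWords {m : Multiset α} {w : List α} :
    w ∈ nestedWords m ↔ (w : Multiset α) = m ∧ IsNested w := by
  simp only [nestedWords, Finset.mem_filter, Multiset.mem_toFinset, Multiset.mem_lists_iff]
  exact and_congr_left fun _ => eq_comm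

/-- Two copies of the maximal letter must be adjacent, since a letter between them would have to be
larger still. -/
theorem exists_eq_insert_replicate {m : Multiset α} {x : α} {n : ℕ} (hn0 : 1 ≤ n) (hn : n ≤ 2)
    (hm : ∀ y ∈ m, y < x) {w : List α} (hw : (w : Multiset α) = m + Multiset.replicate n x)
    (hnest : IsNested w) :
    ∃ s t : List α, w = s ++ List.replicate n x ++ t ∧ ((s ++ t : List α) : Multiset α) = m := by
  have hxm : x ∉ m := fun hx => lt_irrefl x (hm x hx)
  have finish : ∀ s t : List α, w = s ++ List.replicate n x ++ t →
      ∃ s t : List α, w = s ++ List.replicate n x ++ t ∧ ((s ++ t : List α) : Multiset α) = m := by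
    intro s t e
    refine ⟨s, t, e, ?_⟩
    have : ((s ++ t : List α) : Multiset α) + Multiset.replicate n x =
        m + Multiset.replicate n x := by
      rw [← hw, e, ← Multiset.coe_add, ← Multiset.coe_add, ← Multiset.coe_add,
        ← Multiset.coe_replicate]
      abel
    exact add_right_cancel this
  have hcount : w.count x = n := by
    rw [← Multiset.coe_count, hw, Multiset.count_add, Multiset.count_replicate_self,
      Multiset.count_eq_zero_of_notMem hxm, zero_add]
  have hle : ∀ y ∈ w, y ≤ x := by
    intro y hy
    rw [← Multiset.mem_coe, hw, Multiset.mem_add] at hy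
    rcases hy with hy | hy
    · exact (hm y hy).le
    · exact (Multiset.eq_of_mem_replicate hy).le
  obtain ⟨s, t, rfl⟩ := List.append_of_mem (List.count_pos_iff.mp (by omega : 0 < w.count x))
  obtain rfl | rfl : n = 1 ∨ n = 2 := by omega
  · exact finish s t (by simp)
  · rw [List.count_append, List.count_cons_self] at hcount
    by_cases hxt : x ∈ t
    · obtain ⟨u, v, rfl⟩ := List.append_of_mem hxt
      cases u with
      | nil => exact finish s v (by simp)
      | cons b u =>
        exfalso
        have hb : x < b := by
          refine hnest x b (List.Sublist.trans ?_ (List.sublist_append_right _ _))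
          simp
        exact absurd (hle b (by simp)) (not_le.mpr hb)
    · have hxs : x ∈ s := by
        rw [List.count_eq_zero_of_not_mem hxt] at hcount
        exact List.count_pos_iff.mp (by omega)
      obtain ⟨u, v, rfl⟩ := List.append_of_mem hxs
      cases v with
      | nil => exact finish u t (by simp)
      | cons b v =>
        exfalso
        have hb : x < b := by
          refine hnest x b ?_
          rw [List.append_assoc]
          refine List.Sublist.trans ?_ (List.sublist_append_right _ _)
          simp
        exact absurd (hle b (by simp)) (not_le.mpr hb)

/-- Insertion is a bijection: deleting `x` recovers the word, and the first occurrence of `x`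
recovers the slot. -/
theorem sum_nestedWords_add_replicate {β : Type*} [AddCommMonoid β] (f : List α → β)
    {m : Multiset α} {x : α} {n : ℕ} (hn0 : 1 ≤ n) (hn : n ≤ 2) (hm : ∀ y ∈ m, y < x) :
    ∑ w ∈ nestedWords (m + Multiset.replicate n x), f w =
      ∑ w ∈ nestedWords m, ∑ g ∈ Finset.range (w.length + 1), f (insertBlock x n g w) := by
  have hlt : ∀ w ∈ nestedWords m, ∀ y ∈ w, y < x := by
    intro w hw y hy
    rw [mem_nestedWords] at hw
    exact hm y (by rw [← hw.1]; exact hy)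
  have hfilter : ∀ w ∈ nestedWords m, ∀ g,
      (insertBlock x n g w).filter (fun y => decide (y ≠ x)) = w := by
    intro w hw g
    rw [insertBlock, filter_ne_append_replicate_append, List.take_append_drop]
    · exact fun hx => lt_irrefl x (hlt w hw x (List.mem_of_mem_take hx))
    · exact fun hx => lt_irrefl x (hlt w hw x (List.mem_of_mem_drop hx))
  have hidx : ∀ w ∈ nestedWords m, ∀ g ≤ w.length, (insertBlock x n g w).idxOf x = g := by
    intro w hw g hg
    rw [insertBlock, List.append_assoc, List.idxOf_append_of_notMem, List.length_take,
      min_eq_left hg]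
    · obtain ⟨n, rfl⟩ : ∃ l, n = l + 1 := ⟨n - 1, by omega⟩
      simp [List.replicate_succ]
    · exact fun hx => lt_irrefl x (hlt w hw x (List.mem_of_mem_take hx))
  rw [Finset.sum_sigma']
  symm
  refine Finset.sum_bij (fun q _ => insertBlock x n q.2 q.1) ?_ ?_ ?_ ?_
  · rintro ⟨w, g⟩ hq
    rw [Finset.mem_sigma] at hq
    have hw := hlt w hq.1
    have hmem := mem_nestedWords.mp hq.1
    refine mem_nestedWords.mpr ⟨?_, ?_⟩
    · rw [← hmem.1, insertBlock, ← Multiset.coe_replicate]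
      conv_rhs => rw [← List.take_append_drop g w]
      simp only [← Multiset.coe_add]
      abel
    · refine IsNested.append_replicate_append hn (fun y hy => hw y (List.mem_of_mem_take hy))
        (fun y hy => hw y (List.mem_of_mem_drop hy)) ?_
      rw [List.take_append_drop]
      exact hmem.2
  · rintro ⟨w, g⟩ hq ⟨w', g'⟩ hq' e
    rw [Finset.mem_sigma, Finset.mem_range] at hq hq'
    dsimp only at hq hq' e
    have h1 : w = w' := by rw [← hfilter w hq.1 g, e, hfilter w' hq'.1 g']
    have h2 : g = g' := by
      rw [← hidx w hq.1 g (by omega), e, hidx w' hq'.1 g' (by omega)]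
    rw [h1, h2]
  · intro w hw
    rw [mem_nestedWords] at hw
    obtain ⟨s, t, rfl, hst⟩ := exists_eq_insert_replicate hn0 hn hm hw.1 hw.2
    refine ⟨⟨s ++ t, s.length⟩, ?_, ?_⟩
    · rw [Finset.mem_sigma, Finset.mem_range, mem_nestedWords]
      refine ⟨⟨hst, hw.2.sublist ?_⟩, ?_⟩
      · rw [List.append_assoc]
        exact (List.sublist_append_right _ _).append_left s
      · simp
    · simp [insertBlock]
  · intros
    rfl

/-- The generating polynomial of `des + 1` over the nested arrangements of a multiset. -/
noncomputable def descentSeries (m : Multiset α) : PowerSeries ℤ :=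
  ∑ w ∈ nestedWords m, PowerSeries.X ^ (descents w + 1)

/-- The operator depends on the number of slots only, not on the block size, so one statement serves
both the barred letter and the plain pair. -/
theorem descentSeries_add_replicate {m : Multiset α} {x : α} {n : ℕ} (hn : n ≤ 1)
    (hm : ∀ y ∈ m, y < x) :
    descentSeries (m + Multiset.replicate (n + 1) x) =
      eulerOp (Multiset.card m + 1) (descentSeries m) := by
  rw [descentSeries, sum_nestedWords_add_replicate _ (by omega) (by omega) hm, descentSeries,
    eulerOp_sum]
  refine Finset.sum_congr rfl fun w hw => ?_
  have hw := (mem_nestedWords.mp hw).1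
  rw [sum_X_pow_descents_insertBlock x n w fun y hy => hm y (by rw [← hw]; exact hy), ← hw,
    Multiset.coe_card]

theorem descentSeries_zero : descentSeries (0 : Multiset α) = PowerSeries.X := by
  have : nestedWords (0 : Multiset α) = {[]} := by
    ext w
    rw [mem_nestedWords, Finset.mem_singleton, Multiset.coe_eq_zero]
    refine ⟨fun h => h.1, ?_⟩
    rintro rfl
    exact ⟨rfl, fun a y h => by simp at h⟩
  rw [descentSeries, this, Finset.sum_singleton, descents, zero_add, pow_one]

end Words

/-! ### Jacobi-Stirling permutations -/

theorem M_zero : M 0 = 0 := rfl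

theorem letters_eq_replicate_add_replicate (a b : Letter) :
    ({a, a, b} : Multiset Letter) = Multiset.replicate 1 b + Multiset.replicate 2 a :=
  Multiset.coe_eq_coe.mpr (List.perm_append_comm (l₁ := [a, a]) (l₂ := [b]))

theorem M_succ (k : ℕ) : M (k + 1) = M k + {plain (k + 1), plain (k + 1), bar (k + 1)} := by
  rw [M, Finset.sum_Icc_succ_top (by omega), ← M]

theorem card_M (k : ℕ) : Multiset.card (M k) = 3 * k := by
  induction k with
  | zero => rfl
  | succ k ih =>
    rw [M_succ, Multiset.card_add, ih]
    simp
    ring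

theorem lt_bar_succ_of_mem_M {k : ℕ} {y : Letter} (hy : y ∈ M k) : y < bar (k + 1) := by
  rw [M, Multiset.mem_sum] at hy
  obtain ⟨m, hm, hy⟩ := hy
  rw [Finset.mem_Icc] at hm
  have h := plain_lt_bar (show m < k + 1 by omega)
  simp only [Multiset.insert_eq_cons, Multiset.mem_cons, Multiset.mem_singleton] at hy
  rcases hy with rfl | rfl | rfl
  · exact h
  · exact h
  · exact (bar_lt_plain m).trans h

theorem bar_injective : Function.Injective bar := fun m n h => by
  simpa [bar] using h

theorem barred_succ (k : ℕ) : barred (k + 1) = insert (bar (k + 1)) (barred k) := by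
  rw [barred, ← Finset.insert_Icc_right_eq_Icc_add_one (by omega), Finset.image_insert, ← barred]

theorem bar_succ_notMem_barred (k : ℕ) : bar (k + 1) ∉ barred k := by
  rw [barred, Finset.mem_image]
  rintro ⟨m, hm, h⟩
  rw [bar_injective h, Finset.mem_Icc] at hm
  omega

theorem val_le_M_of_subset_barred {k : ℕ} {S : Finset Letter} (hS : S ⊆ barred k) :
    S.val ≤ M k := by
  rw [Multiset.le_iff_subset S.nodup]
  intro y hy
  obtain ⟨m, hm, rfl⟩ := Finset.mem_image.mp (hS hy)
  exact Multiset.mem_sum.mpr ⟨m, hm, by simp⟩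

/-- The barred letter goes in first, being the smaller of the new letters, so that each insertion is
of a maximal letter. -/
theorem descentSeries_M_succ_sub {k : ℕ} {S : Finset Letter} (hS : S ⊆ barred k) :
    descentSeries (M (k + 1) - S.val) = eulerOp (3 * k - S.card + 2)
      (eulerOp (3 * k - S.card + 1) (descentSeries (M k - S.val))) := by
  have hle := val_le_M_of_subset_barred hS
  have hcard : Multiset.card (M k - S.val) = 3 * k - S.card := by
    rw [Multiset.card_sub hle, card_M]
    rfl
  have hlt : ∀ y ∈ M k - S.val, y < bar (k + 1) := fun y hy =>
    lt_bar_succ_of_mem_M (Multiset.mem_of_le tsub_le_self hy)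
  have h : M (k + 1) - S.val = M k - S.val + Multiset.replicate (0 + 1) (bar (k + 1)) +
      Multiset.replicate (1 + 1) (plain (k + 1)) := by
    rw [M_succ, letters_eq_replicate_add_replicate, ← tsub_add_eq_add_tsub hle, add_assoc]
  rw [h, descentSeries_add_replicate le_rfl, descentSeries_add_replicate zero_le_one hlt,
    Multiset.card_add, Multiset.card_replicate, hcard]
  intro y hy
  rw [Multiset.mem_add] at hy
  rcases hy with hy | hy
  · exact (hlt y hy).trans (bar_lt_plain _)
  · rw [Multiset.eq_of_mem_replicate hy]
    exact bar_lt_plain _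

theorem descentSeries_M_succ_sub_insert {k : ℕ} {S : Finset Letter} (hS : S ⊆ barred k) :
    descentSeries (M (k + 1) - (insert (bar (k + 1)) S).val) =
      eulerOp (3 * k - S.card + 1) (descentSeries (M k - S.val)) := by
  have hle := val_le_M_of_subset_barred hS
  have hcard : Multiset.card (M k - S.val) = 3 * k - S.card := by
    rw [Multiset.card_sub hle, card_M]
    rfl
  have h : M (k + 1) - (insert (bar (k + 1)) S).val = M k - S.val +
      Multiset.replicate (1 + 1) (plain (k + 1)) := by
    rw [Finset.insert_val_of_notMem fun h => bar_succ_notMem_barred k (hS h), M_succ]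
    have e : M k + {plain (k + 1), plain (k + 1), bar (k + 1)} =
        M k - S.val + Multiset.replicate (1 + 1) (plain (k + 1)) + (bar (k + 1) ::ₘ S.val) := by
      conv_lhs => rw [← tsub_add_cancel_of_le hle]
      rw [letters_eq_replicate_add_replicate, ← Multiset.singleton_add, Multiset.replicate_one]
      ac_rfl
    rw [e, add_tsub_cancel_right]
  rw [h, descentSeries_add_replicate le_rfl, hcard]
  exact fun y hy =>
    (lt_bar_succ_of_mem_M (Multiset.mem_of_le tsub_le_self hy)).trans (bar_lt_plain _)

/-- The generating polynomial of `des + 1` over `JSP k i`, as a sum over subsets. -/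
noncomputable def jspSeries (k i : ℕ) : PowerSeries ℤ :=
  ∑ S ∈ (barred k).powersetCard i, descentSeries (M k - S.val)

theorem jspSeries_zero_zero : jspSeries 0 0 = PowerSeries.X := by
  rw [jspSeries, Finset.powersetCard_zero, Finset.sum_singleton, M_zero, Finset.empty_val,
    tsub_zero, descentSeries_zero]

theorem card_barred (k : ℕ) : (barred k).card = k := by
  rw [barred, Finset.card_image_of_injective _ bar_injective, Nat.card_Icc, Nat.add_sub_cancel]

theorem jspSeries_eq_zero_of_lt {k i : ℕ} (h : k < i) : jspSeries k i = 0 := by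
  rw [jspSeries, Finset.powersetCard_eq_empty.mpr (by rwa [card_barred]), Finset.sum_empty]

theorem jspSeries_succ_zero (k : ℕ) :
    jspSeries (k + 1) 0 = eulerOp (3 * k + 2) (eulerOp (3 * k + 1) (jspSeries k 0)) := by
  simp only [jspSeries, Finset.powersetCard_zero, Finset.sum_singleton]
  rw [descentSeries_M_succ_sub (Finset.empty_subset _), Finset.card_empty, Nat.sub_zero]

/-- The omitted sets are split by whether they contain `bar (k + 1)`: if so, only the plain pair is
inserted, otherwise two insertions take place. -/
theorem jspSeries_succ_succ (k i : ℕ) :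
    jspSeries (k + 1) (i + 1) = eulerOp (3 * k - i + 1) (jspSeries k i) +
      eulerOp (3 * k - i + 1) (eulerOp (3 * k - i) (jspSeries k (i + 1))) := by
  have hbar := bar_succ_notMem_barred k
  rw [jspSeries, barred_succ, Finset.powersetCard_succ_insert hbar, Finset.sum_union, add_comm,
    Finset.sum_image]
  · congr 1
    · rw [jspSeries, eulerOp_sum]
      refine Finset.sum_congr rfl fun S hS => ?_
      rw [Finset.mem_powersetCard] at hS
      rw [descentSeries_M_succ_sub_insert hS.1, hS.2]
    · rw [jspSeries, eulerOp_sum, eulerOp_sum]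
      refine Finset.sum_congr rfl fun S hS => ?_
      rw [Finset.mem_powersetCard] at hS
      -- The existence of `S` bounds `i`, which keeps the truncated subtractions below exact.
      have hik : i + 1 ≤ k := by
        rw [← hS.2, ← card_barred k]
        exact Finset.card_le_card hS.1
      rw [descentSeries_M_succ_sub hS.1, hS.2, show 3 * k - (i + 1) + 2 = 3 * k - i + 1 by omega,
        show 3 * k - (i + 1) + 1 = 3 * k - i by omega]
  · intro S hS T hT e
    have hS := (Finset.mem_powersetCard.mp hS).1
    have hT := (Finset.mem_powersetCard.mp hT).1
    rw [← Finset.erase_insert fun h => hbar (hS h), e,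
      Finset.erase_insert fun h => hbar (hT h)]
  · rw [Finset.disjoint_left]
    intro S hS hS'
    obtain ⟨T, -, rfl⟩ := Finset.mem_image.mp hS'
    exact hbar ((Finset.mem_powersetCard.mp hS).1 (Finset.mem_insert_self _ _))

/-! ### Comparison of the two recursions -/

theorem eulerOp_one_X : eulerOp 1 PowerSeries.X = eulerOp 1 1 := by
  simp only [eulerOp, PowerSeries.derivative_X, PowerSeries.derivative_one]
  push_cast
  ring

theorem A_succ_eq_jspSeries (k i : ℕ) : A (k + 1) i = jspSeries (k + 1) i := by
  induction k generalizing i with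
  | zero =>
    cases i with
    | zero =>
      rw [A_succ_zero, jspSeries_succ_zero, A_zero_zero, jspSeries_zero_zero]
      -- The initial values differ (`1` for `A`, `t` for the empty word), but `eulerOp 1` sends both
      -- to `t`; hence agreement starts at level 1.
      exact congrArg _ eulerOp_one_X.symm
    | succ i =>
      rcases Nat.eq_zero_or_pos i with rfl | hi
      · rw [A_succ_succ le_rfl, jspSeries_succ_succ, A_zero_zero, jspSeries_zero_zero,
          zero_add, A_eq_zero_of_lt zero_lt_one, jspSeries_eq_zero_of_lt zero_lt_one]
        exact congrArg (· + _) eulerOp_one_X.symm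
      · rw [A_eq_zero_of_lt (by omega), jspSeries_eq_zero_of_lt (by omega)]
  | succ k ih =>
    cases i with
    | zero => rw [A_succ_zero, jspSeries_succ_zero, ih]
    | succ i =>
      rcases Nat.lt_or_ge (k + 1) i with hi | hi
      · rw [A_eq_zero_of_lt (by omega), jspSeries_eq_zero_of_lt (by omega)]
      · rw [A_succ_succ hi, jspSeries_succ_succ, ih, ih]

theorem JSPS_eq_nestedWords (k : ℕ) (S : Finset Letter) : JSPS k S = nestedWords (M k - S.val) := by
  ext π
  rw [mem_JSPS, mem_nestedWords, ← forall_fin_lt_iff_isNested]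
  rfl

theorem sum_JSP_X_pow_des (k i : ℕ) :
    ∑ π ∈ JSP k i, (PowerSeries.X : PowerSeries ℤ) ^ (des π + 1) = jspSeries k i := by
  rw [JSP, Finset.sum_biUnion, jspSeries]
  · refine Finset.sum_congr rfl fun S _ => ?_
    rw [JSPS_eq_nestedWords, descentSeries]
    exact Finset.sum_congr rfl fun π _ => by rw [← card_descent_positions π]; rfl
  -- The content of a word determines the omitted set, as `S = M k - (M k - S)` for `S ≤ M k`.
  · intro S hS T hT hne
    refine Finset.disjoint_left.mpr fun π hπ hπ' => hne ?_
    have h := ((mem_JSPS k S π).mp hπ).1.symm.trans ((mem_JSPS k T π).mp hπ').1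
    have hS := val_le_M_of_subset_barred (Finset.mem_powersetCard.mp hS).1
    have hT := val_le_M_of_subset_barred (Finset.mem_powersetCard.mp hT).1
    refine Finset.val_injective ?_
    rw [← tsub_tsub_cancel_of_le hS, h, tsub_tsub_cancel_of_le hT]

theorem coeff_succ_jspSeries (k i j : ℕ) :
    PowerSeries.coeff (j + 1) (jspSeries k i) =
      (((JSP k i).filter fun π => des π = j).card : ℤ) := by
  rw [← sum_JSP_X_pow_des, map_sum, Finset.card_filter]
  push_cast
  refine Finset.sum_congr rfl fun π _ => ?_
  rw [PowerSeries.coeff_X_pow]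
  exact if_congr (by omega) rfl rfl

end JacobiStirling

theorem theorem2 (k i : ℕ) (hk : 1 ≤ k) (hi : i ≤ k) :
    JacobiStirling.A k i =
        ∑ j ∈ Finset.Icc 1 (2 * k - i),
          PowerSeries.monomial j (JacobiStirling.a k i j) ∧
      ∀ j : ℕ, 1 ≤ j → j ≤ 2 * k - i →
        JacobiStirling.a k i j =
          (((JacobiStirling.JSP k i).filter fun π => JacobiStirling.des π = j - 1).card : ℤ) := by
  obtain ⟨k, rfl⟩ : ∃ l, k = l + 1 := ⟨k - 1, by omega⟩
  constructor
  · ext n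
    simp only [map_sum, PowerSeries.coeff_monomial, Finset.sum_ite_eq, Finset.mem_Icc]
    split_ifs with h
    · rfl
    -- Outside the range, the constant term vanishes because `p (k + 1) i 0 = 0`, and the high
    -- coefficients by the degree bound.
    · rcases Nat.eq_zero_or_pos n with rfl | hn
      · exact JacobiStirling.coeff_zero_A_succ k i
      · exact JacobiStirling.coeff_A_of_lt hi n (by omega)
  · intro j hj _
    obtain ⟨j, rfl⟩ : ∃ l, j = l + 1 := ⟨j - 1, by omega⟩
    rw [JacobiStirling.a, JacobiStirling.A_succ_eq_jspSeries, JacobiStirling.coeff_succ_jspSeries,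
      Nat.add_sub_cancel]
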